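/- Let $n\ge 0$ and let $\lambda=(\lambda_1\ge\dots\ge\lambda_n\ge 0)$ be a partition, identified with its left-justified shape having $n$ rows of lengths $\lambda_1,\dots,\lambda_n$. Let $R_\lambda=\{q_1<\dots<q_r\}$ be the set of the lengths of the columns of $\lambda$ that are less than $n$, put $q_0:=0$, $q_{r+1}:=n$, and call the intervals $(q_{h-1},q_h]=\{q_{h-1}+1,\dots,q_h\}$, $1\le h\le r+1$, the carrels. Let $\beta=(\beta_1,\dots,\beta_n)$ be an upper $\lambda$-tuple, i.e. $\beta_i\in\{1,\dots,n\}$ and $\beta_i\ge i$ for all $i$. In the $h$-th carrel define the critical indices of $\beta$ from right to left: $x_1:=q_h$, and, as long as it exists, $x_u$ is the maximal index with $q_{h-1}<x_u<x_{u-1}$ and $\beta_{x_{u-1}}-\beta_{x_u}>x_{u-1}-x_u$. For an index $i$ let $x(i)$ be the smallest critical index $\ge i$ in the carrel of $i$. Then $\beta\in UGC_\lambda(n)$ (gapless core) means that for every $h\in\{1,\dots,r\}$ one has $\beta_{q_h}\le\beta_k$, where $k$ is the leftmost critical index of the carrel $(q_h,q_{h+1}]$; and $\beta\in UBP_\lambda(n)$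 (bounded by its platform) means that $\beta_i\le\beta_{x(i)}$ for all $i$. Let $s_\lambda(\beta;x)=\sum_T x_1^{\theta_1(T)}\cdots x_n^{\theta_n(T)}$, where $T$ runs over the semistandard tableaux of shape $\lambda$ with values in $\{1,\dots,n\}$ (rows weakly increasing, columns strictly increasing) whose values in row $i$ are at most $\beta_i$ for every $i$, and $\theta_k(T)$ is the number of values of $T$ equal to $k$. For integers $u$ and $1\le i,k\le n$ let $h_u(i,k;x):=0$ if $u<0$ and otherwise $h_u(i,k;x):=\sum_{i\le t_1\le\dots\le t_u\le k}x_{t_1}\cdots x_{t_u}$. If $\beta\in UGC_\lambda(n)\cap UBP_\lambda(n)$, then, as polynomials in $\mathbb{Z}[x_1,\dots,x_n]$, $$ s_\lambda(\beta;x)=\det\bigl(h_{\lambda_j-j+i}(i,\beta_j;x)\bigr)_{1\le i,j\le n}. $$ -/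

import Mathlib

/-!
Conventions: everything is indexed from `0`.  The index `i : Fin n` stands for the index `i + 1`
of `[n] = {1, …, n}`, and likewise for the entries of `n`-tuples with entries in `[n]`
(elements of `Fin n → Fin n`), for the values of tableaux and for the variables.
A divider `q ∈ R ⊆ {1, …, n - 1}` is not shifted: it separates the first `q` indices from the
remaining ones, i.e. the indices `i < q` from the indices `q ≤ i`.
-/

namespace RowBound

open Finset

/-! ### `R`-tuples -/

section Tuples

variable {n : ℕ}

/-- Upper tuples: `β i ≥ i` for all `i`. -/
def U (n : ℕ) : Set (Fin n → Fin n) := {β | ∀ i, i ≤ β i}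

/-- `i` and `k` lie in the same carrel: no divider `q ∈ R` separates them. -/
def SameCarrel (R : Finset ℕ) (i k : Fin n) : Prop :=
  ∀ q ∈ R, q ≤ (i : ℕ) ↔ q ≤ (k : ℕ)

/-- `i` is the last index of its carrel: a divider (or the end of the tuple) follows it. -/
def IsCarrelEnd (R : Finset ℕ) (i : Fin n) : Prop :=
  (i : ℕ) + 1 ∈ R ∨ (i : ℕ) + 1 = n

/-- `β_y - β_x > y - x`, as integers. -/
def SteepRise (β : Fin n → Fin n) (x y : Fin n) : Prop :=
  ((y : ℕ) : ℤ) - ((x : ℕ) : ℤ) < ((β y : ℕ) : ℤ) - ((β x : ℕ) : ℤ)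

/-- The critical indices of `β`, found from the right within each carrel: the last index of the
carrel is critical, and the next critical index to the left of a critical index `y` is the maximal
`x < y` in the same carrel (if there is one) with `β_y - β_x > y - x`. -/
inductive IsCritical (R : Finset ℕ) (β : Fin n → Fin n) : Fin n → Prop
  | last (x : Fin n) (hx : IsCarrelEnd R x) : IsCritical R β x
  | next (x y : Fin n) (hy : IsCritical R β y) (hxy : x < y) (hc : SameCarrel R x y)
      (hd : SteepRise β x y) (hmax : ∀ z, x < z → z < y → ¬ SteepRise β z y) : IsCritical R β x

theorem exists_critical (R : Finset ℕ) (β : Fin n → Fin n) (i : Fin n) :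
    ∃ x, IsCritical R β x ∧ SameCarrel R i x ∧ i ≤ x := by
  classical
  have hne : (univ.filter fun x : Fin n => SameCarrel R i x ∧ i ≤ x).Nonempty :=
    ⟨i, mem_filter.2 ⟨mem_univ _, fun _ _ => Iff.rfl, le_rfl⟩⟩
  obtain ⟨x, hx, hmax⟩ := exists_max_image _ (fun x : Fin n => (x : ℕ)) hne
  simp only [mem_filter, mem_univ, true_and] at hx hmax
  refine ⟨x, .last x ?_, hx⟩
  by_contra hcon
  simp only [IsCarrelEnd, not_or] at hcon
  have hlt : (x : ℕ) + 1 < n := by have := x.2; omega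
  have hix : (i : ℕ) ≤ x := hx.2
  have := hmax ⟨x + 1, hlt⟩ ⟨fun q hq => ?_, Fin.le_def.2 (by simp; omega)⟩
  · simp at this
  · have h1 := hx.1 q hq
    have h2 : q ≠ (x : ℕ) + 1 := fun h => hcon.1 (h ▸ hq)
    simp only
    omega

open Classical in
/-- The first critical index at or to the right of `i` within the carrel of `i`. -/
noncomputable def nextCritical (R : Finset ℕ) (β : Fin n → Fin n) (i : Fin n) : Fin n :=
  (univ.filter fun x => IsCritical R β x ∧ SameCarrel R i x ∧ i ≤ x).min'
    (by obtain ⟨x, hx⟩ := exists_critical R β i; exact ⟨x, by simpa using hx⟩)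

/-- The `R`-platform `Ξ_R(β)`: its entry at `i` is the critical entry `β_x` at the
first critical index `x ≥ i` in the carrel of `i`. -/
noncomputable def platform (R : Finset ℕ) (β : Fin n → Fin n) : Fin n → Fin n :=
  fun i => β (nextCritical R β i)

/-- The critical list of `β` is a flag critical list: for each divider `q ∈ R`, the (critical)
entry at the last index `i` before `q` is at most the critical entry at the leftmost critical
index `k` of the carrel that begins right after `q`, with first index `j`. -/
def HasFlagCriticalList (R : Finset ℕ) (β : Fin n → Fin n) : Prop :=
  ∀ q ∈ R, ∀ i j k : Fin n, (i : ℕ) + 1 = q → (j : ℕ) = q →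
    IsLeast {x | IsCritical R β x ∧ SameCarrel R j x} k → β i ≤ β k

/-- Gapless core `R`-tuples. -/
def UGC (n : ℕ) (R : Finset ℕ) : Set (Fin n → Fin n) :=
  {β | β ∈ U n ∧ HasFlagCriticalList R β}

/-- Upper `R`-tuples that are bounded by their platform. -/
def UBP (n : ℕ) (R : Finset ℕ) : Set (Fin n → Fin n) :=
  {β | β ∈ U n ∧ β ≤ platform R β}

end Tuples

/-! ### Shapes, tableaux, polynomials -/

section Tableaux

variable {n : ℕ}

/-- The shape of the partition `lam 0 ≥ lam 1 ≥ … ≥ lam (n - 1) ≥ 0`: the boxes are the pairs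
(row `i`, column `j`) with `i < n` and `j < lam i`. -/
def shape (lam : Fin n → ℕ) (hlam : Antitone lam) : YoungDiagram where
  cells := univ.biUnion fun i : Fin n => (range (lam i)).image fun j => ((i : ℕ), j)
  isLowerSet := by
    rintro ⟨a, b⟩ ⟨c, d⟩ ⟨hca, hdb⟩ h
    simp only [coe_biUnion, Set.mem_iUnion, mem_coe, mem_image, mem_range, Prod.mk.injEq,
      mem_univ, exists_prop, true_and] at h ⊢
    obtain ⟨i, j, hj, rfl, rfl⟩ := h
    simp only at hca hdb
    have hcn : c < n := lt_of_le_of_lt hca i.2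
    have hle : lam i ≤ lam ⟨c, hcn⟩ := hlam (Fin.le_def.2 hca)
    exact ⟨⟨c, hcn⟩, d, by omega, rfl, rfl⟩

/-- `R_λ`: the set of the lengths of the columns of the shape `λ` that are less than `n`. -/
def colLengths (lam : Fin n → ℕ) (hlam : Antitone lam) : Finset ℕ :=
  ((range ((shape lam hlam).rowLen 0)).image (shape lam hlam).colLen).filter (· < n)

/-- The row bound set of tableaux: the semistandard tableaux `T` of shape `λ` with values in
`{0, …, n - 1}` whose values in row `i` are at most `β i`. -/
def rowBoundSet (lam : Fin n → ℕ) (hlam : Antitone lam) (β : Fin n → Fin n) :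
    Set (SemistandardYoungTableau (shape lam hlam)) :=
  {T | (∀ c ∈ (shape lam hlam).cells, T c.1 c.2 < n) ∧
    ∀ i : Fin n, ∀ j < lam i, T i j ≤ (β i : ℕ)}

theorem rowBoundSet_finite (lam : Fin n → ℕ) (hlam : Antitone lam) (β : Fin n → Fin n) :
    (rowBoundSet lam hlam β).Finite := by
  let f : rowBoundSet lam hlam β → ((shape lam hlam).cells → Fin n) :=
    fun T c => ⟨T.1 c.1.1 c.1.2, T.2.1 c.1 c.2⟩
  have hf : Function.Injective f := by
    rintro ⟨S, hS⟩ ⟨T, hT⟩ h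
    apply Subtype.ext
    apply SemistandardYoungTableau.ext
    intro i j
    by_cases hc : (i, j) ∈ shape lam hlam
    · have := congrFun h ⟨(i, j), hc⟩
      simpa [f] using this
    · simp only
      rw [S.zeros hc, T.zeros hc]
  exact Set.finite_coe_iff.1 (Finite.of_injective f hf)

/-- The content of `T`: the number of boxes of `T` with value `k`. -/
def content {μ : YoungDiagram} (T : SemistandardYoungTableau μ) (k : ℕ) : ℕ :=
  (μ.cells.filter fun c => T c.1 c.2 = k).card

/-- The row bound sum `s_λ(β; x)`. -/
noncomputable def rowBoundSum (lam : Fin n → ℕ) (hlam : Antitone lam) (β : Fin n → Fin n) :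
    MvPolynomial (Fin n) ℤ :=
  ∑ T ∈ (rowBoundSet_finite lam hlam β).toFinset,
    ∏ k : Fin n, MvPolynomial.X k ^ content T k

open Classical in
/-- `h_u(i, k; x)`: zero for `u < 0`, otherwise the sum of `x_{t_1} ⋯ x_{t_u}` over all
`i ≤ t_1 ≤ … ≤ t_u ≤ k`. -/
noncomputable def completeHom (u : ℤ) (i k : Fin n) : MvPolynomial (Fin n) ℤ :=
  if u < 0 then 0
  else ∑ t : Fin u.toNat → Fin n with Monotone t ∧ ∀ s, i ≤ t s ∧ t s ≤ k,
    ∏ s, MvPolynomial.X (t s)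

end Tableaux

end RowBound

/-! Replace `β` by its platform, the tuple `i ↦ β_{x(i)}`. Neither side changes, and the new bounds
are weakly increasing, so the flagged Jacobi–Trudi identity applies.

Between `i` and `x(i)` all rows have equal length (`lam_eq_of_sameCarrel`), and `β_i ≤ β_{x(i)} ≤
β_i + (x(i) - i)`: the left inequality is membership in UBP, the right one is the way critical
indices are chosen (`not_steepRise_nextCritical`). On the tableau side, strictness down a column
already forces an entry of row `i` to lie at least `x(i) - i` below the entry of row `x(i)`, so the
two bounds cut out the same tableaux (`fillings_congr`). On the determinant side, the recursion
`h_u(i,k) = h_u(i,k-1) + x_k h_{u-1}(i,k)` turns a change of bound into column operations inside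
such a block (`det_jtMatrix_congr`). The flag condition makes the platform increasing across
carrels; inside a carrel this is automatic (`platform_monotone`).

For increasing bounds (`fillingSum_eq_det`), let `p` be the first row with the largest bound.
Lowering that bound by one loses the tableaux whose row `p` ends in its maximal value, and deleting
that last box expresses the loss through a smaller shape. Expanding column `p` of the determinant
gives the same recursion. -/

namespace RowBound

open Finset

/-! ### Complete homogeneous polynomials in an interval of variables -/

section CompleteHomogeneous

variable {R : Type*} [CommRing R]

/-- The complete homogeneous polynomial of degree `u` in the elements `x i, …, x (k - 1)`. -/
def hsum (x : ℕ → R) (i : ℕ) : ℕ → ℕ → R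
  | 0, _ => 1
  | _ + 1, 0 => 0
  | u + 1, k + 1 => if i ≤ k then hsum x i (u + 1) k + x k * hsum x i u (k + 1) else 0

/-- `hsum` with an integral degree; it vanishes in negative degrees. -/
def hsumInt (x : ℕ → R) (i : ℕ) (u : ℤ) (k : ℕ) : R :=
  if u < 0 then 0 else hsum x i u.toNat k

theorem hsum_eq_zero (x : ℕ → R) {i u k : ℕ} (hu : 0 < u) (hk : k ≤ i) : hsum x i u k = 0 := by
  obtain ⟨v, rfl⟩ : ∃ v, u = v + 1 := ⟨u - 1, by omega⟩
  cases k with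
  | zero => simp [hsum]
  | succ k => simp [hsum, show ¬ i ≤ k by omega]

theorem hsumInt_of_neg (x : ℕ → R) {i k : ℕ} {u : ℤ} (hu : u < 0) : hsumInt x i u k = 0 := by
  simp [hsumInt, hu]

theorem hsumInt_zero (x : ℕ → R) (i k : ℕ) : hsumInt x i 0 k = 1 := by
  simp [hsumInt, hsum]

theorem hsumInt_natCast (x : ℕ → R) (i u k : ℕ) : hsumInt x i u k = hsum x i u k := by
  simp [hsumInt]

theorem hsumInt_eq_zero (x : ℕ → R) {i k : ℕ} {u : ℤ} (hu : 0 < u) (hk : k ≤ i) :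
    hsumInt x i u k = 0 := by
  rw [hsumInt, if_neg (by omega), hsum_eq_zero x (by omega) hk]

/-- Split by whether `x k` occurs. For `k < i` the interval is empty on both sides, and the only
failure is in degree 1, where the spurious term `x k * h_0 = x k` survives; the hypothesis excludes
exactly this. -/
theorem hsumInt_succ (x : ℕ → R) {i k : ℕ} (u : ℤ) (h : i ≤ k ∨ u ≠ 1) :
    hsumInt x i u (k + 1) = hsumInt x i u k + x k * hsumInt x i (u - 1) (k + 1) := by
  rcases lt_trichotomy u 0 with hu | rfl | hu
  · simp [hsumInt_of_neg x hu, hsumInt_of_neg x (show u - 1 < 0 by omega)]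
  · simp [hsumInt_zero, hsumInt_of_neg]
  · obtain ⟨v, rfl⟩ : ∃ v : ℕ, u = ((v + 1 : ℕ) : ℤ) := ⟨(u - 1).toNat, by omega⟩
    by_cases hik : i ≤ k
    · rw [show ((v + 1 : ℕ) : ℤ) - 1 = (v : ℕ) by push_cast; ring]
      simp only [hsumInt_natCast]
      rw [hsum, if_pos hik]
    · rw [hsumInt_eq_zero x hu (by omega), hsumInt_eq_zero x hu (by omega),
        hsumInt_eq_zero x (by omega) (by omega)]
      simp

end CompleteHomogeneous

/-! ### Row bound tableaux as functions on `ℕ × ℕ` -/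

section FunctionTableaux

/-- Semistandard fillings of the shape with rows `lam 0, …, lam (n - 1)`, extended by zero, whose
values in row `i` are less than `c i`. -/
def fillings (n : ℕ) (lam c : ℕ → ℕ) : Set (ℕ → ℕ → ℕ) :=
  {T | (∀ i j, ¬ (i < n ∧ j < lam i) → T i j = 0) ∧
    (∀ i < n, ∀ j, j + 1 < lam i → T i j ≤ T i (j + 1)) ∧
    (∀ i, i + 1 < n → ∀ j < lam (i + 1), T i j < T (i + 1) j) ∧
    ∀ i < n, ∀ j < lam i, T i j < c i}

theorem fillings_finite (n : ℕ) (lam c : ℕ → ℕ) : (fillings n lam c).Finite := by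
  let f : fillings n lam c → ((i : Fin n) → Fin (lam i) → Fin (c i)) :=
    fun T i j => ⟨T.1 i j, T.2.2.2.2 i i.2 j j.2⟩
  have hf : Function.Injective f := by
    rintro ⟨S, hS⟩ ⟨T, hT⟩ h
    apply Subtype.ext
    funext i j
    by_cases hc : i < n ∧ j < lam i
    · have := congrFun (congrFun h ⟨i, hc.1⟩) ⟨j, hc.2⟩
      simpa [f] using this
    · change S i j = T i j
      rw [hS.1 i j hc, hT.1 i j hc]
  exact Set.finite_coe_iff.1 (Finite.of_injective f hf)

variable {R : Type*} [CommRing R]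

/-- The product of `x v` over the values `v` in the boxes of a filling. -/
def fillingWeight (x : ℕ → R) (n : ℕ) (lam : ℕ → ℕ) (T : ℕ → ℕ → ℕ) : R :=
  ∏ i ∈ range n, ∏ j ∈ range (lam i), x (T i j)

/-- The generating function of `fillings n lam c`. -/
noncomputable def fillingSum (x : ℕ → R) (n : ℕ) (lam c : ℕ → ℕ) : R :=
  ∑ᶠ T ∈ fillings n lam c, fillingWeight x n lam T

theorem row_le_of_mem_fillings {n : ℕ} {lam c : ℕ → ℕ} {T : ℕ → ℕ → ℕ} (hT : T ∈ fillings n lam c)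
    {i : ℕ} (hi : i < n) {j k : ℕ} (hjk : j ≤ k) (hk : k < lam i) : T i j ≤ T i k := by
  induction k, hjk using Nat.le_induction with
  | base => rfl
  | succ k hjk ih => exact (ih (by omega)).trans (hT.2.1 i hi k hk)

theorem col_add_le_of_mem_fillings {n : ℕ} {lam c : ℕ → ℕ} {T : ℕ → ℕ → ℕ}
    (hT : T ∈ fillings n lam c) (hlam : ∀ i j, i ≤ j → j < n → lam j ≤ lam i)
    {i k : ℕ} (hik : i ≤ k) (hk : k < n) {j : ℕ} (hj : j < lam k) : T i j + (k - i) ≤ T k j := by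
  induction k, hik using Nat.le_induction with
  | base => simp
  | succ k hik ih =>
    have h1 := ih (by omega) (hj.trans_le (hlam k (k + 1) (by omega) hk))
    have h2 := hT.2.2.1 k hk j hj
    omega

/-- Lowering the bound of row `p` by one discards the fillings in which the last value of that
row attains its bound. -/
theorem fillings_eq_union {n : ℕ} {lam c : ℕ → ℕ} {p m : ℕ} (hp : p < n) (hm : c p = m + 1) :
    fillings n lam c = fillings n lam (Function.update c p m) ∪
      {T ∈ fillings n lam c | 0 < lam p ∧ T p (lam p - 1) = m} := by
  ext T
  constructor
  · intro hT
    by_cases h : 0 < lam p ∧ T p (lam p - 1) = m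
    · exact Or.inr ⟨hT, h⟩
    · refine Or.inl ⟨hT.1, hT.2.1, hT.2.2.1, fun i hi j hj => ?_⟩
      have h1 := hT.2.2.2 i hi j hj
      rcases eq_or_ne i p with rfl | hip
      · have h2 := row_le_of_mem_fillings hT hi (show j ≤ lam i - 1 by omega) (by omega)
        have h3 := hT.2.2.2 i hi (lam i - 1) (by omega)
        have h4 : T i (lam i - 1) ≠ m := fun h' => h ⟨by omega, h'⟩
        rw [Function.update_self]
        omega
      · rwa [Function.update_of_ne hip]
  · rintro (hT | hT)
    · refine ⟨hT.1, hT.2.1, hT.2.2.1, fun i hi j hj => ?_⟩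
      have h1 := hT.2.2.2 i hi j hj
      rcases eq_or_ne i p with rfl | hip
      · rw [Function.update_self] at h1
        omega
      · rwa [Function.update_of_ne hip] at h1
    · exact hT.1

theorem fillingSum_eq_add (x : ℕ → R) {n : ℕ} {lam c : ℕ → ℕ} {p m : ℕ} (hp : p < n)
    (hm : c p = m + 1) :
    fillingSum x n lam c = fillingSum x n lam (Function.update c p m) +
      ∑ᶠ T ∈ {T ∈ fillings n lam c | 0 < lam p ∧ T p (lam p - 1) = m},
        fillingWeight x n lam T := by
  conv_lhs => rw [fillingSum, fillings_eq_union hp hm]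
  rw [finsum_mem_union _ (fillings_finite _ _ _)
    ((fillings_finite n lam c).subset fun T hT => hT.1), fillingSum]
  refine Set.disjoint_left.2 fun T hT hT' => ?_
  have := hT.2.2.2 p hp (lam p - 1) (by have := hT'.2.1; omega)
  rw [Function.update_self, hT'.2.2] at this
  exact lt_irrefl _ this

theorem fillingWeight_update (x : ℕ → R) {n : ℕ} {lam : ℕ → ℕ} {p l m : ℕ} (hp : p < n)
    (hl : lam p = l + 1) (T : ℕ → ℕ → ℕ) :
    fillingWeight x n lam (Function.update T p (Function.update (T p) l m)) =
      x m * fillingWeight x n (Function.update lam p l) T := by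
  have hpm : p ∈ range n := mem_range.2 hp
  rw [fillingWeight, fillingWeight, ← mul_prod_erase _ _ hpm, ← mul_prod_erase _ _ hpm,
    ← mul_assoc]
  congr 1
  · rw [hl, prod_range_succ, Function.update_self, Function.update_self, Function.update_self,
      mul_comm]
    congr 1
    refine prod_congr rfl fun j hj => ?_
    rw [Function.update_of_ne (by have := mem_range.1 hj; omega)]
  · refine prod_congr rfl fun i hi => ?_
    have hip : i ≠ p := (mem_erase.1 hi).1
    rw [Function.update_of_ne hip, Function.update_of_ne hip]

/-- Deleting the last box of row `p` is a bijection onto the fillings of the smaller shape. The box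
can always be put back: `m` is the largest value allowed in row `p`, and the row above stays below
`m`. -/
theorem finsum_last_eq (x : ℕ → R) {n : ℕ} {lam c : ℕ → ℕ} {p l m : ℕ} (hp : p < n)
    (hl : lam p = l + 1) (hm : c p = m + 1) (hnext : p + 1 < n → lam (p + 1) ≤ l)
    (hprev : ∀ i, i + 1 = p → c i ≤ m ∧ lam p ≤ lam i) :
    ∑ᶠ T ∈ {T ∈ fillings n lam c | 0 < lam p ∧ T p (lam p - 1) = m}, fillingWeight x n lam T =
      x m * fillingSum x n (Function.update lam p l) c := by
  have himage : {T ∈ fillings n lam c | 0 < lam p ∧ T p (lam p - 1) = m} =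
      (fun T : ℕ → ℕ → ℕ => Function.update T p (Function.update (T p) l m)) ''
        fillings n (Function.update lam p l) c := by
    ext T
    constructor
    · rintro ⟨hT, -, hTm⟩
      rw [hl, Nat.add_sub_cancel] at hTm
      -- The deleted box is reset to 0, the value required outside the shape.
      refine ⟨Function.update T p (Function.update (T p) l 0), ⟨?_, ?_, ?_, ?_⟩, ?_⟩
      · intro i j hij
        have := hT.1 i j
        rcases eq_or_ne i p with rfl | hip
        · simp only [Function.update_self] at hij ⊢
          rcases eq_or_ne j l with rfl | hjl
          · simp
          · rw [Function.update_of_ne hjl]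
            apply this
            omega
        · rw [Function.update_of_ne hip] at hij ⊢
          exact this hij
      · intro i hi j hj
        rcases eq_or_ne i p with rfl | hip
        · simp only [Function.update_self] at hj ⊢
          rw [Function.update_of_ne (by omega), Function.update_of_ne (by omega)]
          exact hT.2.1 i hi j (by omega)
        · rw [Function.update_of_ne hip] at hj ⊢
          exact hT.2.1 i hi j hj
      · intro i hi j hj
        have h1 := hT.2.2.1 i hi j
        rcases eq_or_ne i p with rfl | hip
        · rw [Function.update_of_ne (show i + 1 ≠ i by omega)] at hj ⊢
          have := hnext hi
          rw [Function.update_self, Function.update_of_ne (by omega)]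
          exact h1 hj
        · rw [Function.update_of_ne hip]
          rcases eq_or_ne (i + 1) p with rfl | hip'
          · simp only [Function.update_self] at hj ⊢
            rw [Function.update_of_ne (by omega)]
            exact h1 (by omega)
          · rw [Function.update_of_ne hip'] at hj ⊢
            exact h1 hj
      · intro i hi j hj
        rcases eq_or_ne i p with rfl | hip
        · simp only [Function.update_self] at hj ⊢
          rw [Function.update_of_ne (by omega)]
          exact hT.2.2.2 i hi j (by omega)
        · rw [Function.update_of_ne hip] at hj ⊢
          exact hT.2.2.2 i hi j hj
      · simp [← hTm]
    · rintro ⟨T, hT, rfl⟩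
      obtain ⟨hT0, hT1, hT2, hT3⟩ := hT
      refine ⟨⟨?_, ?_, ?_, ?_⟩, by omega, by simp [hl]⟩
      · intro i j hij
        have h1 := hT0 i j
        dsimp only
        rcases eq_or_ne i p with rfl | hip
        · simp only [Function.update_self] at h1 ⊢
          rw [Function.update_of_ne (by omega)]
          exact h1 (by omega)
        · rw [Function.update_of_ne hip] at h1 ⊢
          exact h1 hij
      · intro i hi j hj
        have h1 := hT1 i hi j
        dsimp only
        rcases eq_or_ne i p with rfl | hip
        · simp only [Function.update_self] at h1 ⊢
          rw [Function.update_of_ne (show j ≠ l by omega)]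
          rcases eq_or_ne (j + 1) l with rfl | hjl
          · have := hT3 i hi j (by rw [Function.update_self]; omega)
            rw [Function.update_self]
            omega
          · rw [Function.update_of_ne hjl]
            exact h1 (by omega)
        · rw [Function.update_of_ne hip] at h1 ⊢
          exact h1 hj
      · intro i hi j hj
        have h1 := hT2 i hi j
        dsimp only
        rcases eq_or_ne i p with rfl | hip
        · have := hnext hi
          rw [Function.update_of_ne (show i + 1 ≠ i by omega)] at h1 ⊢
          rw [Function.update_self, Function.update_of_ne (by omega)]
          exact h1 hj
        · rw [Function.update_of_ne hip]
          rcases eq_or_ne (i + 1) p with rfl | hip'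
          · simp only [Function.update_self] at h1 ⊢
            rcases eq_or_ne j l with rfl | hjl
            · have h2 := hprev i rfl
              have := hT3 i (by omega) j (by rw [Function.update_of_ne hip]; omega)
              rw [Function.update_self]
              omega
            · rw [Function.update_of_ne hjl]
              exact h1 (by omega)
          · rw [Function.update_of_ne hip'] at h1 ⊢
            exact h1 hj
      · intro i hi j hj
        have h1 := hT3 i hi j
        dsimp only
        rcases eq_or_ne i p with rfl | hip
        · simp only [Function.update_self] at h1 ⊢
          rcases eq_or_ne j l with rfl | hjl
          · rw [Function.update_self]
            omega
          · rw [Function.update_of_ne hjl]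
            exact h1 (by omega)
        · rw [Function.update_of_ne hip] at h1 ⊢
          exact h1 hj
  rw [himage, finsum_mem_image, fillingSum, mul_finsum_mem' _ _ (fillings_finite _ _ _)]
  · exact finsum_mem_congr rfl fun T _ => fillingWeight_update x hp hl T
  · intro S hS T hT hST
    funext i j
    have h := congrFun (congrFun hST i) j
    dsimp only at h
    rcases eq_or_ne i p with rfl | hip
    · rcases eq_or_ne j l with rfl | hjl
      · rw [hS.1 i j (by simp), hT.1 i j (by simp)]
      · simpa [Function.update_of_ne hjl] using h
    · simpa [Function.update_of_ne hip] using h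

end FunctionTableaux

/-! ### Flagged Jacobi–Trudi identity for weakly increasing bounds -/

section FlaggedJacobiTrudi

variable {R : Type*} [CommRing R]

/-- The vector with entries `h_{a + i}` in the elements `x i, …, x (k - 1)`. -/
def jtCol (x : ℕ → R) (n : ℕ) (a : ℤ) (k : ℕ) : Fin n → R :=
  fun i => hsumInt x i (a + ((i : ℕ) : ℤ)) k

/-- The Jacobi–Trudi matrix of the shape `lam` with row bounds `c`. -/
def jtMatrix (x : ℕ → R) (n : ℕ) (lam c : ℕ → ℕ) : Matrix (Fin n) (Fin n) R :=
  Matrix.of fun i j => jtCol x n ((lam j : ℤ) - ((j : ℕ) : ℤ)) (c j) i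

theorem jtMatrix_apply (x : ℕ → R) (n : ℕ) (lam c : ℕ → ℕ) (i j : Fin n) :
    jtMatrix x n lam c i j = hsumInt x i ((lam j : ℤ) - ((j : ℕ) : ℤ) + ((i : ℕ) : ℤ)) (c j) :=
  rfl

theorem jtCol_succ (x : ℕ → R) {n : ℕ} (a : ℤ) {k : ℕ}
    (h : ∀ i : Fin n, (i : ℕ) ≤ k ∨ a + ((i : ℕ) : ℤ) ≠ 1) :
    jtCol x n a (k + 1) = jtCol x n a k + x k • jtCol x n (a - 1) (k + 1) := by
  funext i
  simp only [jtCol, Pi.add_apply, Pi.smul_apply, smul_eq_mul]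
  rw [hsumInt_succ x _ (h i), show a - 1 + ((i : ℕ) : ℤ) = a + ((i : ℕ) : ℤ) - 1 by ring]

theorem updateCol_jtMatrix (x : ℕ → R) {n : ℕ} {lam c lam' c' : ℕ → ℕ} (p : Fin n)
    (hlam : ∀ j : Fin n, j ≠ p → lam' j = lam j) (hc : ∀ j : Fin n, j ≠ p → c' j = c j) :
    (jtMatrix x n lam c).updateCol p (jtCol x n ((lam' p : ℤ) - ((p : ℕ) : ℤ)) (c' p)) =
      jtMatrix x n lam' c' := by
  ext i j
  rcases eq_or_ne j p with rfl | hj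
  · rw [Matrix.updateCol_self]
    rfl
  · rw [Matrix.updateCol_ne hj, jtMatrix_apply, jtMatrix_apply, hlam j hj, hc j hj]

/-- Lowering the bound of the column `p` of the Jacobi–Trudi matrix. -/
theorem det_jtMatrix_eq_add (x : ℕ → R) {n : ℕ} {lam c : ℕ → ℕ} {m : ℕ} (p : Fin n)
    (hm : c p = m + 1) (hn : n ≤ m + 1) :
    (jtMatrix x n lam c).det = (jtMatrix x n lam (Function.update c p m)).det +
      x m * ((jtMatrix x n lam c).updateCol p
        (jtCol x n ((lam p : ℤ) - ((p : ℕ) : ℤ) - 1) (m + 1))).det := by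
  have hne : ∀ j : Fin n, j ≠ p → (j : ℕ) ≠ p := fun j hj h => hj (Fin.ext h)
  rw [← Matrix.det_updateCol_smul]
  conv_lhs => rw [← updateCol_jtMatrix x (lam' := lam) (c' := c) p (fun _ _ => rfl)
    (fun _ _ => rfl), hm, jtCol_succ x _ (fun i => Or.inl (by have := i.2; omega)),
    Matrix.det_updateCol_add]
  congr 2
  rw [← updateCol_jtMatrix x (lam := lam) (c := c) (lam' := lam) (c' := Function.update c p m) p
    (fun _ _ => rfl) (fun j hj => Function.update_of_ne (hne j hj) _ _), Function.update_self]

/-- In the last row the variables run from `x n` up to below `c j ≤ n`, so there are none. Entries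
of positive degree vanish and only the diagonal entry, of degree `lam n = 0`, remains. -/
theorem det_jtMatrix_succ_of_le (x : ℕ → R) {n : ℕ} {lam c : ℕ → ℕ} (hc : ∀ i ≤ n, c i ≤ n)
    (hlam : lam n = 0) : (jtMatrix x (n + 1) lam c).det = (jtMatrix x n lam c).det := by
  rw [Matrix.det_succ_row _ (Fin.last n), Finset.sum_eq_single (Fin.last n)]
  · have h1 : jtMatrix x (n + 1) lam c (Fin.last n) (Fin.last n) = 1 := by
      rw [jtMatrix_apply]
      simp [hlam, hsumInt_zero]
    rw [h1, ← two_mul, pow_mul, neg_one_sq, one_pow, one_mul, one_mul]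
    congr 1
    ext i j
    simp [jtMatrix_apply]
  · intro j _ hj
    have hjn : (j : ℕ) < n := by
      have := j.2
      have : (j : ℕ) ≠ n := fun h => hj (Fin.ext h)
      omega
    rw [jtMatrix_apply, hsumInt_eq_zero x (by simp; omega) (by simpa using hc j hjn.le)]
    simp
  · simp

theorem det_jtMatrix_succ_eq_zero (x : ℕ → R) {n : ℕ} {lam c : ℕ → ℕ} (hc : ∀ i ≤ n, c i ≤ n)
    (hlam : 0 < lam n) : (jtMatrix x (n + 1) lam c).det = 0 := by
  refine Matrix.det_eq_zero_of_row_eq_zero (Fin.last n) fun j => ?_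
  have hjn : (j : ℕ) ≤ n := Nat.lt_succ_iff.1 j.2
  rw [jtMatrix_apply, hsumInt_eq_zero x _ (by simpa using hc j hjn)]
  rcases hjn.eq_or_lt with h | h
  · simp [h, hlam]
  · simp
    omega

theorem fillings_succ_of_eq_zero {n : ℕ} {lam c : ℕ → ℕ} (hlam : lam n = 0) :
    fillings (n + 1) lam c = fillings n lam c := by
  have key : ∀ i j, i < n + 1 → j < lam i → i < n := fun i j hi hj => by
    rcases Nat.lt_succ_iff_lt_or_eq.1 hi with h | rfl
    · exact h
    · omega
  ext T
  constructor
  · rintro ⟨h0, h1, h2, h3⟩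
    exact ⟨fun i j hij => h0 i j fun h => hij ⟨key i j h.1 h.2, h.2⟩,
      fun i hi => h1 i (by omega), fun i hi => h2 i (by omega), fun i hi => h3 i (by omega)⟩
  · rintro ⟨h0, h1, h2, h3⟩
    exact ⟨fun i j hij => h0 i j fun h => hij ⟨by omega, h.2⟩,
      fun i hi j hj => h1 i (key i _ hi hj) j hj, fun i hi j hj => h2 i (key _ _ hi hj) j hj,
      fun i hi j hj => h3 i (key i _ hi hj) j hj⟩

theorem fillingSum_succ_of_eq_zero (x : ℕ → R) {n : ℕ} {lam c : ℕ → ℕ} (hlam : lam n = 0) :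
    fillingSum x (n + 1) lam c = fillingSum x n lam c := by
  rw [fillingSum, fillings_succ_of_eq_zero hlam, fillingSum]
  exact finsum_mem_congr rfl fun T _ => by simp [fillingWeight, prod_range_succ, hlam]

theorem fillingSum_succ_eq_zero (x : ℕ → R) {n : ℕ} {lam c : ℕ → ℕ}
    (hanti : ∀ i j, i ≤ j → j < n + 1 → lam j ≤ lam i) (hc : c n ≤ n)
    (hlam : 0 < lam n) : fillingSum x (n + 1) lam c = 0 := by
  have : fillings (n + 1) lam c = ∅ := by
    refine Set.eq_empty_of_forall_notMem fun T hT => ?_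
    have h1 := col_add_le_of_mem_fillings hT hanti (Nat.zero_le n) (Nat.lt_succ_self n) hlam
    have h2 := hT.2.2.2 n (Nat.lt_succ_self n) 0 hlam
    omega
  rw [fillingSum, this, finsum_mem_empty]

theorem fillingSum_zero (x : ℕ → R) (lam c : ℕ → ℕ) : fillingSum x 0 lam c = 1 := by
  have : fillings 0 lam c = {fun _ _ => 0} := by
    ext T
    simp only [fillings, Set.mem_ofPred_eq, Set.mem_singleton_iff]
    constructor
    · rintro ⟨h, -⟩
      funext i j
      exact h i j (by omega)
    · rintro rfl
      simp
  rw [fillingSum, this, finsum_mem_singleton]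
  simp [fillingWeight]

/-- The two sides of the Jacobi–Trudi identity satisfy the same recursion. -/
theorem fillingSum_eq_det_of_lower (x : ℕ → R) {n : ℕ} {lam c : ℕ → ℕ} {p m : ℕ} (hp : p < n)
    (hm : c p = m + 1) (hn : n ≤ m + 1)
    (hanti : ∀ i j, i ≤ j → j < n → lam j ≤ lam i)
    (hprev : ∀ i, i < p → c i ≤ m) (hnext : ∀ i, p ≤ i → i < n → c i = m + 1)
    (h1 : fillingSum x n lam (Function.update c p m) =
      (jtMatrix x n lam (Function.update c p m)).det)
    (h2 : ∀ l, lam p = l + 1 → (p + 1 < n → lam (p + 1) ≤ l) →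
      fillingSum x n (Function.update lam p l) c =
        (jtMatrix x n (Function.update lam p l) c).det) :
    fillingSum x n lam c = (jtMatrix x n lam c).det := by
  lift p to Fin n using hp
  have hne : ∀ j : Fin n, j ≠ p → (j : ℕ) ≠ p := fun j hj h => hj (Fin.ext h)
  rw [fillingSum_eq_add x p.2 hm, det_jtMatrix_eq_add x p hm hn, h1]
  congr 1
  -- If no box of row `p` can be removed, both correction terms vanish. When row `p + 1` has equal
  -- length, a value `m` ending row `p` leaves no room below it, and the modified column `p`
  -- coincides with column `p + 1`. When `p` is the last row and is empty, the modified column has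
  -- only negative degrees.
  by_cases hstep : ∃ l, lam p = l + 1 ∧ ((p : ℕ) + 1 < n → lam (p + 1) ≤ l)
  · obtain ⟨l, hl, hl'⟩ := hstep
    rw [finsum_last_eq x p.2 hl hm hl' fun i hi =>
      ⟨hprev i (by omega), hanti i p (by omega) p.2⟩, h2 l hl hl']
    rw [← updateCol_jtMatrix x (lam := lam) (c := c) (lam' := Function.update lam p l) (c' := c) p
      (fun j hj => Function.update_of_ne (hne j hj) _ _) (fun _ _ => rfl), Function.update_self,
      hm, hl, show ((l + 1 : ℕ) : ℤ) - ((p : ℕ) : ℤ) - 1 = (l : ℤ) - ((p : ℕ) : ℤ) by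
        push_cast; ring]
  · by_cases hpn : (p : ℕ) + 1 < n
    · have hle := hanti p (p + 1) (by omega) hpn
      have heq : lam (p + 1) = lam p := by
        by_contra hcon
        exact hstep ⟨lam p - 1, by omega, fun _ => by omega⟩
      have hempty : {T ∈ fillings n lam c | 0 < lam p ∧ T p (lam p - 1) = m} = ∅ := by
        refine Set.eq_empty_of_forall_notMem ?_
        rintro T ⟨hT, hpos, hTm⟩
        have h3 := hT.2.2.1 p hpn (lam p - 1) (by omega)
        have h4 := hT.2.2.2 (p + 1) hpn (lam p - 1) (by omega)
        rw [hnext (p + 1) (by omega) hpn] at h4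
        omega
      have hp' : (⟨p + 1, hpn⟩ : Fin n) ≠ p := fun h => by
        have := congrArg Fin.val h
        simp at this
      rw [hempty, finsum_mem_empty, Matrix.det_zero_of_column_eq hp', mul_zero]
      intro k
      rw [Matrix.updateCol_ne hp', Matrix.updateCol_self, jtMatrix_apply, jtCol]
      simp only
      rw [hnext (p + 1) (by omega) hpn, heq]
      congr 1
      push_cast
      ring
    · have hp0 : lam p = 0 := by
        by_contra hcon
        exact hstep ⟨lam p - 1, by omega, fun h => absurd h hpn⟩
      have hempty : {T ∈ fillings n lam c | 0 < lam p ∧ T p (lam p - 1) = m} = ∅ := by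
        refine Set.eq_empty_of_forall_notMem ?_
        rintro T ⟨-, hpos, -⟩
        omega
      rw [hempty, finsum_mem_empty, Matrix.det_eq_zero_of_column_eq_zero p, mul_zero]
      intro i
      rw [Matrix.updateCol_self, jtCol, hsumInt_of_neg]
      have := i.2
      omega

theorem sum_update_lt {n p m : ℕ} (f : ℕ → ℕ) (hp : p < n) (hm : m < f p) :
    ∑ i ∈ range n, Function.update f p m i < ∑ i ∈ range n, f i := by
  refine sum_lt_sum (fun i _ => ?_) ⟨p, mem_range.2 hp, by simpa using hm⟩
  rcases eq_or_ne i p with rfl | h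
  · simpa using hm.le
  · rw [Function.update_of_ne h]

/-- The Jacobi–Trudi identity for weakly increasing row bounds. -/
theorem fillingSum_eq_det (x : ℕ → R) (n : ℕ) (lam c : ℕ → ℕ)
    (hanti : ∀ i j, i ≤ j → j < n → lam j ≤ lam i) (hmono : ∀ i j, i ≤ j → j < n → c i ≤ c j)
    (hup : ∀ i, i + 1 < n → i + 1 ≤ c i) :
    fillingSum x n lam c = (jtMatrix x n lam c).det := by
  induction n generalizing lam c with
  | zero => simp [fillingSum_zero]
  | succ n ihn =>
    -- Each recursion step lowers either one bound or one row length, so the total of both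
    -- decreases; the outer induction removes a row.
    induction hN : ∑ i ∈ range (n + 1), lam i + ∑ i ∈ range (n + 1), c i using Nat.strong_induction_on
      generalizing lam c with
    | _ N ih =>
      subst hN
      -- If every bound is at most `n`, a column of length `n + 1` cannot be filled: either the last
      -- row is empty and can be dropped, or both sides are 0.
      by_cases hcn : c n ≤ n
      · have hc : ∀ i ≤ n, c i ≤ n := fun i hi => (hmono i n hi (by omega)).trans hcn
        rcases Nat.eq_zero_or_pos (lam n) with h0 | hpos
        · rw [fillingSum_succ_of_eq_zero x h0, det_jtMatrix_succ_of_le x hc h0]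
          exact ihn lam c (fun i j h hj => hanti i j h (by omega))
            (fun i j h hj => hmono i j h (by omega)) (fun i hi => hup i (by omega))
        · rw [fillingSum_succ_eq_zero x hanti hcn hpos, det_jtMatrix_succ_eq_zero x hc hpos]
      · obtain ⟨m, hm⟩ : ∃ m, c n = m + 1 := ⟨c n - 1, by omega⟩
        have hex : ∃ p, c p = m + 1 := ⟨n, hm⟩
        classical
        -- Taking the first row with maximal bound keeps the bounds increasing after lowering, keeps
        -- the rows above below `m`, and gives row `p + 1` the same bound as row `p`.
        obtain ⟨p, hpdef⟩ : ∃ p, p = Nat.find hex := ⟨_, rfl⟩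
        have hp : c p = m + 1 := hpdef ▸ Nat.find_spec hex
        have hpn : p ≤ n := hpdef ▸ Nat.find_min' hex hm
        have hprev : ∀ i, i < p → c i ≤ m := fun i hi => by
          have h1 : c i ≠ m + 1 := Nat.find_min hex (hpdef ▸ hi)
          have h2 := hmono i n (by omega) (by omega)
          omega
        have hnext : ∀ i, p ≤ i → i < n + 1 → c i = m + 1 := fun i hi hin => by
          have h1 := hmono p i hi hin
          have h2 := hmono i n (by omega) (by omega)
          omega
        refine fillingSum_eq_det_of_lower x (show p < n + 1 by omega) hp (by omega) hanti hprev hnext ?_ ?_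
        · refine ih _ ?_ lam _ hanti ?_ ?_ rfl
          · exact Nat.add_lt_add_left (sum_update_lt c (by omega) (by omega)) _
          · intro i j hij hj
            have := hmono i j hij hj
            simp only [Function.update_apply]
            split_ifs with h1 h2 h2
            · rfl
            · rw [h1] at this
              omega
            · exact hprev i (by omega)
            · exact this
          · intro i hi
            have := hup i hi
            simp only [Function.update_apply]
            split_ifs <;> omega
        · intro l hl hl'
          refine ih _ ?_ _ c ?_ hmono hup rfl
          · exact Nat.add_lt_add_right (sum_update_lt lam (by omega) (by omega)) _
          · intro i j hij hj
            have := hanti i j hij hj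
            simp only [Function.update_apply]
            split_ifs with h1 h2 h2
            · rfl
            · rw [h1] at this
              omega
            · have h3 := hl' (by omega)
              have h4 := hanti (p + 1) j (by omega) hj
              omega
            · exact this

end FlaggedJacobiTrudi

/-! ### Changing the bounds within blocks of equal rows -/

section ColumnOperations

variable {R : Type*} [CommRing R]

/-- Each column is altered only by columns of `B` strictly to its right, so `A = B * L` with `L`
lower unitriangular. -/
theorem det_eq_of_col_sub_mem_span {n : ℕ} (A B : Matrix (Fin n) (Fin n) R)
    (h : ∀ z, A.col z - B.col z ∈ Submodule.span R (B.col '' (Finset.Ioi z : Finset (Fin n)))) :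
    A.det = B.det := by
  have h' : ∀ z, ∃ a : Fin n → R, ∑ w ∈ Finset.Ioi z, a w • B.col w = A.col z - B.col z :=
    fun z => Submodule.mem_span_image_finset_iff_exists_fun' R |>.1 (h z)
  choose a ha using h'
  let L : Matrix (Fin n) (Fin n) R :=
    Matrix.of fun w z => (if w = z then 1 else 0) + if z < w then a z w else 0
  have hL : L.det = 1 := by
    rw [Matrix.det_of_isLowerTriangular]
    · simp [L]
    · intro w z hwz
      have hwz : w < z := hwz
      simp [L, hwz.ne, hwz.not_gt]
  have hAB : A = B * L := by
    ext i z
    have h1 := congrFun (ha z) i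
    simp only [Finset.sum_apply, Pi.smul_apply, Matrix.col_apply, smul_eq_mul, Pi.sub_apply] at h1
    simp only [L, Matrix.mul_apply, Matrix.of_apply, mul_add, mul_ite, mul_one, mul_zero,
      sum_add_distrib, sum_ite_eq', mem_univ, if_true]
    rw [eq_sub_iff_add_eq'] at h1
    rw [← h1, ← sum_filter]
    congr 1
    refine sum_congr (by ext; simp) fun w _ => mul_comm _ _
  rw [hAB, Matrix.det_mul, hL, mul_one]

/-- Induction on the gap `t - k`. Raising `k` by one costs a multiple of the vector of degree shift
`l - (z + 1)` with bound `k + 1`, which is column `z + 1` with a smaller gap. The condition `t ≤ k +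
(y - z)` keeps `z + 1` in the block as long as a gap remains. -/
theorem jtCol_sub_mem_span (x : ℕ → R) {n : ℕ} {lam c : ℕ → ℕ} {l t y : ℕ} (hy : y < n)
    (e : ℕ) : ∀ (z : Fin n) (k : ℕ), t - k = e → (∀ w, (z : ℕ) ≤ w → w ≤ y → lam w = l ∧ c w = t) →
      (z : ℕ) ≤ y → (z : ℕ) + 1 ≤ k → k ≤ t → t ≤ k + (y - z) →
      jtCol x n ((l : ℤ) - ((z : ℕ) : ℤ)) k - jtCol x n ((l : ℤ) - ((z : ℕ) : ℤ)) t ∈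
        Submodule.span R
          ((jtMatrix x n lam c).col '' (Finset.Ioi z : Finset (Fin n))) := by
  induction e with
  | zero =>
    intro z k he _ _ _ hkt _
    obtain rfl : k = t := by omega
    simp
  | succ e ih =>
    intro z k he hblock hzy hzk hkt htk
    have hz1 : (z : ℕ) + 1 < n := by omega
    have h1 := ih z (k + 1) (by omega) hblock hzy (by omega) (by omega) (by omega)
    have h2 := ih ⟨z + 1, hz1⟩ (k + 1) (by omega)
      (fun w hw => hblock w (by simp at hw; omega)) (by simp; omega) (by simp; omega) (by omega)
      (by simp; omega)
    have h3 : jtCol x n ((l : ℤ) - (((z : ℕ) + 1 : ℕ) : ℤ)) t ∈ Submodule.span R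
        ((jtMatrix x n lam c).col '' (Finset.Ioi z : Finset (Fin n))) := by
      refine Submodule.subset_span ⟨⟨z + 1, hz1⟩, by simp [Fin.lt_def], ?_⟩
      obtain ⟨h4, h5⟩ := hblock (z + 1) (by omega) (by omega)
      funext i
      simp only [Matrix.col_apply, jtMatrix_apply, jtCol, h4, h5]
    have hsub : ((Finset.Ioi (⟨z + 1, hz1⟩ : Fin n) : Finset (Fin n)) : Set (Fin n)) ⊆
        (Finset.Ioi z : Finset (Fin n)) := by
      intro w hw
      simp only [coe_Ioi, Set.mem_Ioi, Fin.lt_def] at hw ⊢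
      omega
    have h2' := Submodule.span_mono (Set.image_mono hsub) h2
    -- For `i > k ≥ z + 1` the degree `l - z + i` is at least 2, so the exceptional degree 1 does
    -- not occur. This is where upperness of the bounds enters.
    have hrec := jtCol_succ x (n := n) ((l : ℤ) - ((z : ℕ) : ℤ)) (k := k) (fun i => by omega)
    rw [show (l : ℤ) - ((z : ℕ) : ℤ) - 1 = (l : ℤ) - (((z : ℕ) + 1 : ℕ) : ℤ) by
      push_cast; ring] at hrec
    have h6 := Submodule.sub_mem _ h1 (Submodule.smul_mem _ (x k) (Submodule.add_mem _ h2' h3))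
    rw [hrec] at h6
    convert h6 using 1
    simp only [sub_add_cancel]
    abel

/-- The determinant does not change when, within blocks of equal rows and equal bounds, the
bounds are lowered by at most the distance to the end of the block. -/
theorem det_jtMatrix_congr (x : ℕ → R) {n : ℕ} {lam b c y : ℕ → ℕ}
    (hblock : ∀ z < n, z ≤ y z ∧ y z < n ∧
      ∀ w, z ≤ w → w ≤ y z → lam w = lam z ∧ c w = c z)
    (hb : ∀ z < n, z + 1 ≤ b z ∧ b z ≤ c z ∧ c z ≤ b z + (y z - z)) :
    (jtMatrix x n lam b).det = (jtMatrix x n lam c).det := by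
  refine det_eq_of_col_sub_mem_span _ _ fun z => ?_
  obtain ⟨h1, h2, h3⟩ := hblock z z.2
  obtain ⟨h4, h5, h6⟩ := hb z z.2
  exact jtCol_sub_mem_span x h2 _ z (b z) rfl h3 h1 h4 h5 h6

/-- The corresponding statement for fillings. -/
theorem fillings_congr {n : ℕ} {lam b c y : ℕ → ℕ}
    (hanti : ∀ i j, i ≤ j → j < n → lam j ≤ lam i)
    (hblock : ∀ z < n, z ≤ y z ∧ y z < n ∧
      ∀ w, z ≤ w → w ≤ y z → lam w = lam z ∧ c w = c z)
    (hb : ∀ z < n, b z ≤ c z ∧ c z ≤ b z + (y z - z)) :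
    fillings n lam b = fillings n lam c := by
  ext T
  constructor
  · rintro ⟨h0, h1, h2, h3⟩
    exact ⟨h0, h1, h2, fun i hi j hj => (h3 i hi j hj).trans_le (hb i hi).1⟩
  · intro hT
    refine ⟨hT.1, hT.2.1, hT.2.2.1, fun i hi j hj => ?_⟩
    obtain ⟨h1, h2, h3⟩ := hblock i hi
    obtain ⟨h4, h5⟩ := hb i hi
    obtain ⟨h6, h7⟩ := h3 (y i) h1 le_rfl
    have h8 := col_add_le_of_mem_fillings hT hanti h1 h2 (h6 ▸ hj)
    have h9 := hT.2.2.2 (y i) h2 j (h6 ▸ hj)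
    omega

end ColumnOperations

/-! ### Passage from tuples and tableaux to sequences on `ℕ` -/

section Extension

variable {n : ℕ} {α : Type*} [Zero α]

/-- Extension by zero of an `n`-tuple to a sequence. -/
def extendZero (f : Fin n → α) (k : ℕ) : α :=
  if h : k < n then f ⟨k, h⟩ else 0

theorem extendZero_of_lt (f : Fin n → α) {k : ℕ} (h : k < n) : extendZero f k = f ⟨k, h⟩ :=
  dif_pos h

@[simp]
theorem extendZero_val (f : Fin n → α) (k : Fin n) : extendZero f k = f k :=
  extendZero_of_lt f k.2

end Extension

section CompleteHom

variable {R : Type*} [CommRing R] {n : ℕ}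

theorem monotone_snoc_iff {u : ℕ} (t : Fin u → Fin n) (a : Fin n) :
    Monotone (Fin.snoc t a : Fin (u + 1) → Fin n) ↔ Monotone t ∧ ∀ s, t s ≤ a := by
  constructor
  · intro h
    refine ⟨fun r s hrs => ?_, fun s => ?_⟩
    · simpa using h (Fin.castSucc_le_castSucc_iff.2 hrs)
    · simpa using h (Fin.le_last s.castSucc)
  · rintro ⟨h1, h2⟩ r s hrs
    induction s using Fin.lastCases with
    | last =>
      induction r using Fin.lastCases with
      | last => rfl
      | cast r => simpa using h2 r
    | cast s =>
      induction r using Fin.lastCases with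
      | last => exact absurd hrs (Fin.castSucc_lt_last s).not_ge
      | cast r => simpa using h1 (Fin.castSucc_le_castSucc_iff.1 hrs)

-- The recursion of `hsum` separates the monotone words by their last letter: either it is less than
-- `k`, or it equals `k` and is stripped off by `Fin.init`.
open Classical in
theorem sum_monotone_eq_hsum (v : Fin n → R) (i : ℕ) (u : ℕ) : ∀ k ≤ n,
    ∑ t : Fin u → Fin n with Monotone t ∧ ∀ s, i ≤ (t s).val ∧ (t s).val < k, ∏ s, v (t s) =
      hsum (extendZero v) i u k := by
  induction u with
  | zero =>
    intro k _
    rw [filter_true_of_mem fun t _ => ⟨fun a => a.elim0, fun s => s.elim0⟩]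
    simp [hsum]
  | succ u ihu =>
    intro k
    induction k with
    | zero =>
      intro _
      rw [hsum, filter_false_of_mem, sum_empty]
      rintro t - ⟨-, h⟩
      exact absurd (h 0).2 (Nat.not_lt_zero _)
    | succ k ihk =>
      intro hk
      rw [hsum]
      split_ifs with hik
      · rw [← ihk (by omega), ← ihu (k + 1) hk, extendZero_of_lt v (show k < n by omega),
          ← sum_filter_add_sum_filter_not _ fun t => (t (Fin.last u) : ℕ) < k, filter_filter,
          filter_filter]
        congr 1
        · refine sum_congr (filter_congr fun t _ => ?_) fun _ _ => rfl
          constructor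
          · rintro ⟨⟨h1, h2⟩, h3⟩
            exact ⟨h1, fun s => ⟨(h2 s).1, (Fin.le_def.1 (h1 (Fin.le_last s))).trans_lt h3⟩⟩
          · rintro ⟨h1, h2⟩
            exact ⟨⟨h1, fun s => ⟨(h2 s).1, by have := (h2 s).2; omega⟩⟩, (h2 _).2⟩
        · rw [mul_sum]
          refine sum_nbij' Fin.init (fun t => Fin.snoc t ⟨k, by omega⟩) ?_ ?_ ?_ ?_ ?_
          · intro t ht
            simp only [mem_filter, mem_univ, true_and] at ht ⊢
            exact ⟨fun r s hrs => ht.1.1 (Fin.castSucc_le_castSucc_iff.2 hrs),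
              fun s => ht.1.2 s.castSucc⟩
          · intro t ht
            simp only [mem_filter, mem_univ, true_and] at ht ⊢
            refine ⟨⟨(monotone_snoc_iff _ _).2 ⟨ht.1, fun s => ?_⟩, fun s => ?_⟩, ?_⟩
            · exact Fin.le_def.2 (Nat.lt_succ_iff.1 (ht.2 s).2)
            · induction s using Fin.lastCases with
              | last => simpa using hik
              | cast s => simpa using ht.2 s
            · simp
          · intro t ht
            simp only [mem_filter, mem_univ, true_and] at ht
            have : t (Fin.last u) = ⟨k, by omega⟩ := by
              have := (ht.1.2 (Fin.last u)).2
              exact Fin.ext (by simp only; omega)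
            rw [← this, Fin.snoc_init_self]
          · intro t _
            exact Fin.init_snoc _ _
          · intro t ht
            simp only [mem_filter, mem_univ, true_and] at ht
            have : t (Fin.last u) = ⟨k, by omega⟩ := by
              have := (ht.1.2 (Fin.last u)).2
              exact Fin.ext (by simp only; omega)
            rw [Fin.prod_univ_castSucc, this, mul_comm]
            rfl
      · rw [filter_false_of_mem, sum_empty]
        rintro t - ⟨-, h⟩
        have := h 0
        omega

theorem completeHom_eq_hsumInt (u : ℤ) (i k : Fin n) :
    completeHom u i k = hsumInt (extendZero MvPolynomial.X) i u (k + 1) := by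
  classical
  rw [completeHom, hsumInt]
  split_ifs
  · rfl
  · rw [← sum_monotone_eq_hsum _ _ _ _ k.2]
    refine sum_congr (filter_congr fun t _ => ?_) fun _ _ => rfl
    simp only [Fin.le_def, Nat.lt_succ_iff]

end CompleteHom

section RowBoundSum

variable {n : ℕ}

theorem mem_shape_iff (lam : Fin n → ℕ) (hlam : Antitone lam) {i j : ℕ} :
    (i, j) ∈ shape lam hlam ↔ i < n ∧ j < extendZero lam i := by
  rw [← YoungDiagram.mem_cells]
  simp only [shape, mem_biUnion, mem_univ, true_and, mem_image, mem_range, Prod.mk.injEq]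
  constructor
  · rintro ⟨a, b, hb, rfl, rfl⟩
    exact ⟨a.2, by simpa using hb⟩
  · rintro ⟨hi, hj⟩
    rw [extendZero_of_lt lam hi] at hj
    exact ⟨⟨i, hi⟩, j, hj, rfl, rfl⟩

theorem extendZero_antitone {lam : Fin n → ℕ} (hlam : Antitone lam) (i j : ℕ) (hij : i ≤ j)
    (hj : j < n) : extendZero lam j ≤ extendZero lam i := by
  rw [extendZero_of_lt lam hj, extendZero_of_lt lam (hij.trans_lt hj)]
  exact hlam hij

theorem image_rowBoundSet (lam : Fin n → ℕ) (hlam : Antitone lam) (β : Fin n → Fin n) :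
    (fun (T : SemistandardYoungTableau (shape lam hlam)) (i j : ℕ) => T i j) ''
      rowBoundSet lam hlam β =
        fillings n (extendZero lam) (extendZero fun i => (β i : ℕ) + 1) := by
  ext T
  constructor
  · rintro ⟨T, hT, rfl⟩
    refine ⟨fun i j hij => T.zeros fun h => hij ((mem_shape_iff lam hlam).1 h),
      fun i hi j hj => T.row_weak (Nat.lt_succ_self j) ((mem_shape_iff lam hlam).2 ⟨hi, hj⟩),
      fun i hi j hj => T.col_strict (Nat.lt_succ_self i) ((mem_shape_iff lam hlam).2 ⟨hi, hj⟩),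
      fun i hi j hj => ?_⟩
    rw [extendZero_of_lt _ hi] at hj ⊢
    exact Nat.lt_succ_iff.2 (hT.2 ⟨i, hi⟩ j hj)
  · intro hT
    refine ⟨⟨T, fun {i j k} hjk h => ?_, fun {i k j} hik h => ?_, fun {i j} h => ?_⟩,
      ⟨fun c hc => ?_, fun i j hj => ?_⟩, rfl⟩
    · have := (mem_shape_iff lam hlam).1 h
      exact row_le_of_mem_fillings hT this.1 hjk.le this.2
    · have := (mem_shape_iff lam hlam).1 h
      have := col_add_le_of_mem_fillings hT (extendZero_antitone hlam) hik.le this.1 this.2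
      omega
    · exact hT.1 i j fun h' => h ((mem_shape_iff lam hlam).2 h')
    · have h1 := (mem_shape_iff lam hlam).1 ((YoungDiagram.mem_cells _).1 hc)
      have h2 := hT.2.2.2 c.1 h1.1 c.2 h1.2
      rw [extendZero_of_lt _ h1.1] at h2
      have h3 := (β ⟨c.1, h1.1⟩).2
      change T c.1 c.2 < n
      omega
    · have h2 := hT.2.2.2 i i.2 j (by simpa using hj)
      rw [extendZero_val] at h2
      exact Nat.lt_succ_iff.1 h2

theorem prod_X_pow_content (lam : Fin n → ℕ) (hlam : Antitone lam) (β : Fin n → Fin n)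
    {T : SemistandardYoungTableau (shape lam hlam)} (hT : T ∈ rowBoundSet lam hlam β) :
    ∏ k : Fin n, (MvPolynomial.X k : MvPolynomial (Fin n) ℤ) ^ content T k =
      fillingWeight (extendZero MvPolynomial.X) n (extendZero lam) fun i j => T i j := by
  have h1 : fillingWeight (extendZero (MvPolynomial.X (R := ℤ) (σ := Fin n))) n (extendZero lam)
      (fun i j => T i j) =
        ∏ c ∈ (shape lam hlam).cells, extendZero (MvPolynomial.X (R := ℤ) (σ := Fin n)) (T c.1 c.2) := by
    rw [fillingWeight, prod_sigma']
    refine prod_bij' (fun a _ => (a.1, a.2)) (fun c _ => ⟨c.1, c.2⟩) ?_ ?_ ?_ ?_ ?_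
    · intro a ha
      simp only [mem_sigma, mem_range] at ha
      exact (YoungDiagram.mem_cells _).2 ((mem_shape_iff lam hlam).2 ha)
    · intro c hc
      simp only [mem_sigma, mem_range]
      exact (mem_shape_iff lam hlam).1 ((YoungDiagram.mem_cells _).1 hc)
    · intro _ _; rfl
    · intro _ _; rfl
    · intro _ _; rfl
  rw [h1, ← prod_fiberwise_of_maps_to (t := range n) (g := fun c => T c.1 c.2)
    fun c hc => mem_range.2 (hT.1 c hc), prod_range]
  refine prod_congr rfl fun k _ => ?_
  rw [prod_congr rfl fun c hc => by rw [(mem_filter.1 hc).2, extendZero_val], prod_const, content]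

theorem rowBoundSum_eq_fillingSum (lam : Fin n → ℕ) (hlam : Antitone lam) (β : Fin n → Fin n) :
    rowBoundSum lam hlam β = fillingSum (extendZero MvPolynomial.X) n (extendZero lam)
      (extendZero fun i => (β i : ℕ) + 1) := by
  rw [fillingSum, ← image_rowBoundSet lam hlam β, finsum_mem_image, rowBoundSum,
    finsum_mem_eq_finite_toFinset_sum _ (rowBoundSet_finite lam hlam β)]
  · exact sum_congr rfl fun T hT =>
      prod_X_pow_content lam hlam β ((Set.Finite.mem_toFinset _).1 hT)
  · intro S _ T _ h
    exact SemistandardYoungTableau.ext fun i j => congrFun (congrFun h i) j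

end RowBoundSum

/-! ### Critical indices and monotonicity of the platform -/

section Platform

variable {n : ℕ} {R : Finset ℕ} {β : Fin n → Fin n}

theorem SameCarrel.symm {i k : Fin n} (h : SameCarrel R i k) : SameCarrel R k i :=
  fun q hq => (h q hq).symm

theorem SameCarrel.trans {i k l : Fin n} (h : SameCarrel R i k) (h' : SameCarrel R k l) :
    SameCarrel R i l :=
  fun q hq => (h q hq).trans (h' q hq)

theorem SameCarrel.of_le_of_le {i k l : Fin n} (h : SameCarrel R i l) (hik : i ≤ k) (hkl : k ≤ l) :
    SameCarrel R i k := fun q hq => by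
  have := h q hq
  rw [Fin.le_def] at hik hkl
  omega

open Classical in
theorem nextCritical_spec (R : Finset ℕ) (β : Fin n → Fin n) (i : Fin n) :
    IsCritical R β (nextCritical R β i) ∧ SameCarrel R i (nextCritical R β i) ∧
      i ≤ nextCritical R β i := by
  have h : nextCritical R β i ∈
      univ.filter fun x => IsCritical R β x ∧ SameCarrel R i x ∧ i ≤ x := min'_mem _ _
  exact (mem_filter.1 h).2

theorem nextCritical_le {i x : Fin n} (hx : IsCritical R β x) (hc : SameCarrel R i x)
    (hix : i ≤ x) : nextCritical R β i ≤ x := by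
  classical
  exact min'_le _ _ (by simpa using ⟨hx, hc, hix⟩)

theorem nextCritical_eq_of_le {i k : Fin n} (hik : i ≤ k) (hk : k ≤ nextCritical R β i) :
    nextCritical R β k = nextCritical R β i := by
  obtain ⟨h1, h2, h3⟩ := nextCritical_spec R β i
  obtain ⟨h4, h5, h6⟩ := nextCritical_spec R β k
  have hik' := h2.of_le_of_le hik hk
  exact le_antisymm (nextCritical_le h1 (hik'.symm.trans h2) hk)
    (nextCritical_le h4 (hik'.trans h5) (hik.trans h6))

/-- Otherwise the rightmost index in `[i, x(i))` with a steep rise to `x(i)` would itself be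
critical, contradicting the minimality of `x(i)`. -/
theorem not_steepRise_nextCritical (i : Fin n) : ¬ SteepRise β i (nextCritical R β i) := by
  classical
  intro h
  obtain ⟨h1, h2, h3⟩ := nextCritical_spec R β i
  have hlt : i < nextCritical R β i := by
    refine h3.lt_of_ne fun he => ?_
    rw [← he] at h
    simp [SteepRise] at h
  obtain ⟨z, hz, hmax⟩ := exists_max_image
    (univ.filter fun z => i ≤ z ∧ z < nextCritical R β i ∧ SteepRise β z (nextCritical R β i)) id
    ⟨i, by simp [hlt, h]⟩
  simp only [mem_filter, mem_univ, true_and, id] at hz hmax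
  have hiz := h2.of_le_of_le hz.1 hz.2.1.le
  have hcrit : IsCritical R β z := .next z _ h1 hz.2.1 (hiz.symm.trans h2) hz.2.2
    fun w hw hw' hs => (hmax w ⟨hz.1.trans hw.le, hw', hs⟩).not_gt hw
  exact (nextCritical_le hcrit hiz hz.1).not_gt hz.2.1

theorem platform_le_platform_succ (h : HasFlagCriticalList R β) {i j : Fin n}
    (hij : (j : ℕ) = i + 1) : platform R β i ≤ platform R β j := by
  have hlt : i < j := Fin.lt_def.2 (by omega)
  obtain ⟨h1, h2, h3⟩ := nextCritical_spec R β i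
  obtain ⟨h4, h5, h6⟩ := nextCritical_spec R β j
  by_cases hcrit : IsCritical R β i
  · have hi : nextCritical R β i = i :=
      le_antisymm (nextCritical_le hcrit (fun _ _ => Iff.rfl) le_rfl) h3
    rw [platform, platform, hi]
    -- Across a divider the inequality is the flag condition, since the next critical index of `j`
    -- is the leftmost one of its carrel. Inside a carrel it comes from the steep rise that made `i`
    -- critical.
    by_cases hR : (i : ℕ) + 1 ∈ R
    · refine h _ hR i j _ rfl hij ⟨⟨h4, h5⟩, fun x hx => nextCritical_le hx.1 hx.2 ?_⟩
      have := hx.2 _ hR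
      rw [Fin.le_def]
      omega
    · cases hcrit with
      | last _ hx =>
        rcases hx with hx | hx
        · exact absurd hx hR
        · have := j.2
          omega
      | next _ y hy hxy hc hd hmax =>
        have hjy : j ≤ y := by
          rw [Fin.le_def]
          rw [Fin.lt_def] at hxy
          omega
        have hjy' : nextCritical R β j ≤ y :=
          nextCritical_le hy ((hc.of_le_of_le hlt.le hjy).symm.trans hc) hjy
        rcases hjy'.eq_or_lt with he | hlt'
        · rw [he, Fin.le_def]
          simp only [SteepRise] at hd
          rw [Fin.lt_def] at hxy
          omega
        -- The rise to `y` is steep from `i` but not from the index in between, so the entry in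
        -- between exceeds `β i`.
        · have := hmax _ (hlt.trans_le h6) hlt'
          simp only [SteepRise, not_lt] at this hd
          rw [Fin.le_def] at h6 ⊢
          omega
  · have hne : i ≠ nextCritical R β i := fun he => hcrit (he ▸ h1)
    have hle : j ≤ nextCritical R β i := by
      have := Fin.lt_def.1 (h3.lt_of_ne hne)
      rw [Fin.le_def]
      omega
    rw [platform, platform, nextCritical_eq_of_le hlt.le hle]

theorem platform_monotone (h : HasFlagCriticalList R β) : Monotone (platform R β) := by
  have key : ∀ d : ℕ, ∀ i j : Fin n, (j : ℕ) = i + d → platform R β i ≤ platform R β j := by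
    intro d
    induction d with
    | zero =>
      intro i j hij
      rw [show j = i from Fin.ext hij]
    | succ d ih =>
      intro i j hij
      have hd : (i : ℕ) + d < n := by
        have := j.2
        omega
      exact (ih i ⟨i + d, hd⟩ rfl).trans (platform_le_platform_succ h hij)
  intro i j hij
  rw [Fin.le_def] at hij
  exact key (j - i) i j (by omega)

/-- If row `k` were shorter than row `i`, the column with index `lam k` would reach row `i` but not
row `k`; its length would be a divider between them. -/
theorem lam_eq_of_sameCarrel {lam : Fin n → ℕ} {hlam : Antitone lam} {i k : Fin n} (hik : i ≤ k)
    (h : SameCarrel (colLengths lam hlam) i k) : lam k = lam i := by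
  by_contra hne
  have hlt : lam k < lam i := (hlam hik).lt_of_ne hne
  have hmem : (i, lam k) ∈ {c : Fin n × ℕ | (c.1.1, c.2) ∈ shape lam hlam} :=
    (mem_shape_iff lam hlam).2 ⟨i.2, by simpa using hlt⟩
  have h1 : (i : ℕ) < (shape lam hlam).colLen (lam k) := YoungDiagram.mem_iff_lt_colLen.1 hmem
  have h2 : (shape lam hlam).colLen (lam k) ≤ k := by
    by_contra hcon
    have := (mem_shape_iff lam hlam).1 (YoungDiagram.mem_iff_lt_colLen.2 (not_le.1 hcon))
    simp at this
  have h3 : lam k < (shape lam hlam).rowLen 0 :=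
    YoungDiagram.mem_iff_lt_rowLen.1
      ((shape lam hlam).up_left_mem (Nat.zero_le _) le_rfl hmem)
  have h4 : (shape lam hlam).colLen (lam k) ∈ colLengths lam hlam :=
    mem_filter.2 ⟨mem_image_of_mem _ (mem_range.2 h3), h2.trans_lt k.2⟩
  have := h _ h4
  omega

end Platform

end RowBound

theorem corollary5p2 (n : ℕ) (lam : Fin n → ℕ) (hlam : Antitone lam) (β : Fin n → Fin n)
    (hU : β ∈ RowBound.U n)
    (hβ : β ∈ RowBound.UGC n (RowBound.colLengths lam hlam) ∩
      RowBound.UBP n (RowBound.colLengths lam hlam)) :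
    RowBound.rowBoundSum lam hlam β =
      Matrix.det (Matrix.of fun i j : Fin n =>
        RowBound.completeHom ((lam j : ℤ) - ((j : ℕ) : ℤ) + ((i : ℕ) : ℤ)) i (β j)) := by
  open RowBound in
  obtain ⟨⟨-, hflag⟩, -, hplat⟩ := hβ
  let L := extendZero lam
  -- The added 1 turns the inclusive bounds `β i` into the exclusive ones of `fillings` and `hsum`.
  let b : ℕ → ℕ := extendZero fun i => (β i : ℕ) + 1
  let c : ℕ → ℕ := extendZero fun i => (platform (colLengths lam hlam) β i : ℕ) + 1
  let y : ℕ → ℕ := extendZero fun i => (nextCritical (colLengths lam hlam) β i : ℕ)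
  let x : ℕ → MvPolynomial (Fin n) ℤ := extendZero MvPolynomial.X
  have hmatrix : (Matrix.of fun i j : Fin n =>
      completeHom ((lam j : ℤ) - ((j : ℕ) : ℤ) + ((i : ℕ) : ℤ)) i (β j)) = jtMatrix x n L b := by
    ext1 i j
    simp only [Matrix.of_apply, jtMatrix_apply, completeHom_eq_hsumInt, L, b, x, extendZero_val]
  have hblock : ∀ z < n, z ≤ y z ∧ y z < n ∧
      ∀ w, z ≤ w → w ≤ y z → L w = L z ∧ c w = c z := by
    intro z hz
    lift z to Fin n using hz
    obtain ⟨-, h2, h3⟩ := nextCritical_spec (colLengths lam hlam) β z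
    simp only [y, L, c, extendZero_val]
    refine ⟨h3, Fin.is_lt _, fun w hzw hwy => ?_⟩
    lift w to Fin n using hwy.trans_lt (Fin.is_lt _)
    rw [extendZero_val, extendZero_val, platform, platform, nextCritical_eq_of_le hzw hwy]
    exact ⟨lam_eq_of_sameCarrel hzw (h2.of_le_of_le hzw hwy), rfl⟩
  have hb : ∀ z < n, z + 1 ≤ b z ∧ b z ≤ c z ∧ c z ≤ b z + (y z - z) := by
    intro z hz
    lift z to Fin n using hz
    have h1 := Fin.le_def.1 (hU z)
    have h2 := Fin.le_def.1 (hplat z)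
    have h3 := not_steepRise_nextCritical (R := colLengths lam hlam) (β := β) z
    have h4 := Fin.le_def.1 (nextCritical_spec (colLengths lam hlam) β z).2.2
    simp only [SteepRise, not_lt] at h3
    simp only [y, b, c, extendZero_val, platform] at h2 ⊢
    omega
  rw [hmatrix, det_jtMatrix_congr x hblock hb, rowBoundSum_eq_fillingSum]
  have hfill : fillings n L b = fillings n L c :=
    fillings_congr (extendZero_antitone hlam) hblock fun z hz => (hb z hz).2
  have hmono : ∀ i j, i ≤ j → j < n → c i ≤ c j := by
    intro i j hij hj
    lift j to Fin n using hj
    lift i to Fin n using hij.trans_lt j.2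
    simp only [c, extendZero_val]
    exact Nat.succ_le_succ (Fin.le_def.1 (platform_monotone hflag hij))
  rw [← fillingSum_eq_det x n L c (extendZero_antitone hlam) hmono fun i hi =>
    (hb i (by omega)).1.trans (hb i (by omega)).2.1]
  change ∑ᶠ T ∈ fillings n L b, _ = ∑ᶠ T ∈ fillings n L c, _
  rw [hfill]
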